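/- Let $\mathcal S$ and $\mathcal A$ be finite sets, $\mathcal A\neq\emptyset$, let $r:\mathcal S\times\mathcal A\to[0,1]$ be a reward function, and for all $s\in\mathcal S$, $a\in\mathcal A$ let $\mathcal P^a_s$ be a nonempty compact subset of the probability simplex $\Delta(\mathcal S)$. Let $\mathcal P=\bigotimes_{s,a}\mathcal P^a_s$ be the resulting $(s,a)$-rectangular uncertainty set of transition kernels. Let $\Pi$ be the set of stationary policies $\pi:\mathcal S\to\Delta(\mathcal A)$ and $\Pi^D\subseteq\Pi$ the set of deterministic ones. For $\pi\in\Pi$ and $\kappa=(\mathsf P_0,\mathsf P_1,\dots)\in\bigotimes_{t\ge0}\mathcal P$, let $\mathbb E_{\pi,\kappa}[\,\cdot\mid S_0=s]$ be the expectation for the process $(S_t,A_t)_{t\ge0}$ with $S_0=s$, $A_t\sim\pi(\cdot|S_t)$ and $S_{t+1}\sim(\mathsf P_t)^{A_t}_{S_t}$, and let $r_t=r(S_t,A_t)$. For $\gamma\in[0,1)$ put $$V^\pi_{\mathcal P,\gamma}(s)=\inf_{\kappa}\mathbb E_{\pi,\kappa}\Big[\sum_{t\ge0}\gamma^t r_t\,\Big|\,S_0=s\Big],\qquad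 V^*_{\mathcal P,\gamma}(s)=\sup_{\pi\in\Pi}V^\pi_{\mathcal P,\gamma}(s),$$ $$g^\pi_{\mathcal P}(s)=\inf_{\kappa}\liminf_{n\to\infty}\mathbb E_{\pi,\kappa}\Big[\frac1n\sum_{t=0}^{n-1}r_t\,\Big|\,S_0=s\Big],\qquad g^*_{\mathcal P}(s)=\sup_{\pi\in\Pi}g^\pi_{\mathcal P}(s),$$ and $\Pi^*=\{\pi\in\Pi: g^\pi_{\mathcal P}=g^*_{\mathcal P}\}$. Call $\pi\in\Pi$ Blackwell optimal if for some $\delta\in(0,1)$ we have $V^\pi_{\mathcal P,\gamma}=V^*_{\mathcal P,\gamma}$ for all $\gamma\in(\delta,1)$. 1. There is $\delta\in(0,1)$ such that for every $\gamma\in(\delta,1)$: there is a deterministic $\pi^*\in\Pi^*$ with $V^{\pi^*}_{\mathcal P,\gamma}=V^*_{\mathcal P,\gamma}$, and every $\pi\in\Pi$ with $V^{\pi}_{\mathcal P,\gamma}=V^*_{\mathcal P,\gamma}$ belongs to $\Pi^*$. 2. If $\arg\max_{\pi\in\Pi^D}g^\pi_{\mathcal P}$ (the set of $\pi\in\Pi^D$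 with $g^{\pi}_{\mathcal P}\ge g^{\pi'}_{\mathcal P}$ entrywise for all $\pi'\in\Pi^D$) is a singleton, then there is exactly one Blackwell optimal policy in $\Pi$. -/

import Mathlib

open MeasureTheory ProbabilityTheory Filter

noncomputable section

namespace RobustMDP

variable {S A : Type*} [Fintype S] [Fintype A]

/-- A stationary (randomized) policy `π : S → Δ(A)`. -/
abbrev Policy (S A : Type*) [Fintype A] := S → stdSimplex ℝ A

/-- A transition kernel `(p_s^a)`, with `p_s^a ∈ Δ(S)` for each `s` and `a`. -/
abbrev TransitionKernel (S A : Type*) [Fintype S] := S → A → stdSimplex ℝ S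

/-- The sequences `κ = (P₀, P₁, …)` of transition kernels that lie in the `(s,a)`-rectangular
uncertainty set `⨂_{s,a} U s a` at each time. -/
def Adversary (U : S → A → Set (stdSimplex ℝ S)) : Set (ℕ → TransitionKernel S A) :=
  {κ | ∀ t s a, κ t s a ∈ U s a}

/-- A deterministic policy puts all its mass on one action in each state. -/
def IsDeterministic (π : Policy S A) : Prop := ∀ s, ∃ a, π s a = 1

/-- The probability measure on a finite type with the given vector of weights. -/
def simplexMeasure {ι : Type*} [Fintype ι] [MeasurableSpace ι] (x : stdSimplex ℝ ι) :
    Measure ι :=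
  ∑ i, ENNReal.ofReal (x i) • Measure.dirac i

instance {ι : Type*} [Fintype ι] [MeasurableSpace ι] (x : stdSimplex ℝ ι) :
    IsProbabilityMeasure (simplexMeasure x) := by
  constructor
  simp only [simplexMeasure, Measure.coe_finsetSum, Finset.sum_apply, Measure.smul_apply,
    measure_univ, smul_eq_mul, mul_one]
  rw [← ENNReal.ofReal_sum_of_nonneg (f := fun i => x i) (fun i _ => x.2.1 i)]
  exact (congrArg ENNReal.ofReal x.2.2).trans ENNReal.ofReal_one

variable [MeasurableSpace S] [DiscreteMeasurableSpace S]
  [MeasurableSpace A] [DiscreteMeasurableSpace A]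

/-- The law of `(s, a)` with `a` drawn from `π(· | s)`. -/
def actLaw (π : Policy S A) (s : S) : Measure (S × A) :=
  (simplexMeasure (π s)).map (fun a => (s, a))

instance (π : Policy S A) (s : S) : IsProbabilityMeasure (actLaw π s) :=
  Measure.isProbabilityMeasure_map (Measurable.of_discrete.aemeasurable)

/-- The law of the next state-action pair: from `(s, a)` the next state `s'` is drawn from
`P s a`, and then the next action from `π(· | s')`. -/
def stepLaw (π : Policy S A) (P : TransitionKernel S A) (x : S × A) : Measure (S × A) :=
  (simplexMeasure (P x.1 x.2)).bind (actLaw π)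

instance (π : Policy S A) (P : TransitionKernel S A) (x : S × A) :
    IsProbabilityMeasure (stepLaw π P x) :=
  isProbabilityMeasure_bind Measurable.of_discrete.aemeasurable (ae_of_all _ fun _ => inferInstance)

/-- The kernel that produces the state-action pair at time `t + 1` from the history up to
time `t`, when the transitions at time `t` follow `P`. -/
def stepKernel (π : Policy S A) (P : TransitionKernel S A) (t : ℕ) :
    Kernel (Finset.Iic t → S × A) (S × A) where
  toFun h := stepLaw π P (h ⟨t, Finset.mem_Iic.2 le_rfl⟩)
  measurable' := Measurable.of_discrete

instance (π : Policy S A) (P : TransitionKernel S A) (t : ℕ) :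
    IsMarkovKernel (stepKernel π P t) :=
  ⟨fun h => inferInstanceAs
    (IsProbabilityMeasure (stepLaw π P (h ⟨t, Finset.mem_Iic.2 le_rfl⟩)))⟩

/-- The law of the trajectory `(S₀, A₀), (S₁, A₁), …` started at `S₀ = s`, when actions follow
`π` and the transition from time `t` to time `t + 1` follows `κ t`. -/
def pathLaw (π : Policy S A) (κ : ℕ → TransitionKernel S A) (s : S) : Measure (ℕ → S × A) :=
  Kernel.trajMeasure (X := fun _ => S × A) (actLaw π s) (fun t => stepKernel π (κ t) t)

/-- `E_{π,κ}[∑_{t ≥ 0} γ^t r_t | S₀ = s]`. -/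
def discountedReturn (r : S → A → ℝ) (γ : ℝ) (π : Policy S A) (κ : ℕ → TransitionKernel S A)
    (s : S) : ℝ :=
  ∫ ω, ∑' t : ℕ, γ ^ t * r (ω t).1 (ω t).2 ∂(pathLaw π κ s)

/-- `E_{π,κ}[(1/n) ∑_{t < n} r_t | S₀ = s]`. -/
def averageReturn (r : S → A → ℝ) (n : ℕ) (π : Policy S A) (κ : ℕ → TransitionKernel S A)
    (s : S) : ℝ :=
  ∫ ω, (1 / (n : ℝ)) * ∑ t ∈ Finset.range n, r (ω t).1 (ω t).2 ∂(pathLaw π κ s)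

/-- The robust discounted value function `V^π_{𝒫,γ}`. -/
def robustDiscountedValue (U : S → A → Set (stdSimplex ℝ S)) (r : S → A → ℝ) (γ : ℝ)
    (π : Policy S A) (s : S) : ℝ :=
  ⨅ κ : Adversary U, discountedReturn r γ π κ s

/-- The robust average-reward value function `g^π_𝒫`. The long-run average along `κ` is read as
the lower limit, so that it is defined for every `κ`. -/
def robustAverageReward (U : S → A → Set (stdSimplex ℝ S)) (r : S → A → ℝ)
    (π : Policy S A) (s : S) : ℝ :=
  ⨅ κ : Adversary U, liminf (fun n : ℕ => averageReturn r n π κ s) atTop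

/-- The optimal robust discounted value function `V^*_{𝒫,γ}`. -/
def optimalDiscountedValue (U : S → A → Set (stdSimplex ℝ S)) (r : S → A → ℝ) (γ : ℝ)
    (s : S) : ℝ :=
  ⨆ π : Policy S A, robustDiscountedValue U r γ π s

/-- The optimal robust average-reward `g^*_𝒫`. -/
def optimalAverageReward (U : S → A → Set (stdSimplex ℝ S)) (r : S → A → ℝ) (s : S) : ℝ :=
  ⨆ π : Policy S A, robustAverageReward U r π s

/-- `Π^*`: the stationary policies that are optimal for the robust average-reward, from every
initial state. -/
def averageOptimalPolicies (U : S → A → Set (stdSimplex ℝ S)) (r : S → A → ℝ) :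
    Set (Policy S A) :=
  {π | robustAverageReward U r π = optimalAverageReward U r}

/-- `argmax_{π ∈ Π^D} g^π_𝒫` over the deterministic policies `Π^D`, for the entrywise order. -/
def deterministicArgmax (U : S → A → Set (stdSimplex ℝ S)) (r : S → A → ℝ) :
    Set (Policy S A) :=
  {π | IsDeterministic π ∧
    ∀ π' : Policy S A, IsDeterministic π' →
      ∀ s, robustAverageReward U r π' s ≤ robustAverageReward U r π s}

/-- A policy is Blackwell optimal if for some `δ ∈ (0,1)` it attains the optimal robust
discounted value function for all discount factors `γ ∈ (δ,1)`. -/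
def IsBlackwellOptimal (U : S → A → Set (stdSimplex ℝ S)) (r : S → A → ℝ)
    (π : Policy S A) : Prop :=
  ∃ δ : ℝ, 0 < δ ∧ δ < 1 ∧ ∀ γ : ℝ, δ < γ → γ < 1 →
    robustDiscountedValue U r γ π = optimalDiscountedValue U r γ

end RobustMDP

end

/-! The core is the vanishing discount limit `tendsto_normalizedValue`: for each fixed policy, `(1 -
γ) V^π_γ → g^π` as `γ → 1`, although the adversary may change kernels over time and the uncertainty
sets are arbitrary compact sets. The normalized values lie in the compact cube `[0,1]^S`, so it
suffices that every cluster point `ℓ` equals `g^π`. Lower bound (`le_liminf`): the Bellman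
inequality passes to the limit as `ℓ ≤ P^π ℓ` for all admissible `P`, so the mean of `ℓ` is
nondecreasing along every adversary. Summing the Bellman inequality at one `γ` with normalized value
near `ℓ` then bounds the average reward from below. Upper bound (`exists_block`,
`exists_liminf_le`): a worst kernel for `γ` near `1`, played for about `ε / (4 (1 - γ))` steps,
yields average reward at most about `ℓ` and barely raises the mean of `ℓ`. Blocks with summable
tolerances and rapidly growing lengths are concatenated. A policy that is discount optimal for
discount factors arbitrarily close to `1` is therefore average optimal. There are finitely many
deterministic policies, so one `δ` excludes all the others at once. A randomized discount optimal
policy reduces to the deterministic selections from its support: all are discount optimal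
(`optimal_of_selection`), and its value always dominates that of one of them
(`exists_selection_le`). If the deterministic argmax is `{π₀}`, then every deterministic discount
optimal policy for `γ ∈ (δ,1)` is `π₀`. Hence `π₀` is Blackwell optimal, and any Blackwell optimal
policy has `π₀` as its only selection, so it equals `π₀`. -/

noncomputable section

namespace RobustMDP

/-! ### Expectations along trajectories as finite sums. -/

variable {S A : Type*} [Fintype S] [Fintype A]

/-- The mean of `h s a` when `a` is drawn from `π(· | s)`. -/
def actMean (π : Policy S A) (h : S → A → ℝ) (s : S) : ℝ := ∑ a, π s a * h s a

/-- The mean of `f s'` when `s'` is drawn from `P s a`. -/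
def nextMean (P : TransitionKernel S A) (f : S → ℝ) (s : S) (a : A) : ℝ := ∑ s', P s a s' * f s'

/-- The mean of `f(S_t)` under `π` and `κ`, as a function of the initial state. -/
def stateMean (π : Policy S A) (κ : ℕ → TransitionKernel S A) : ℕ → (S → ℝ) → S → ℝ
  | 0, f => f
  | t + 1, f => stateMean π κ t (actMean π (nextMean (κ t) f))

variable [MeasurableSpace S] [DiscreteMeasurableSpace S]
  [MeasurableSpace A] [DiscreteMeasurableSpace A]

theorem integral_simplexMeasure {ι : Type*} [Fintype ι] [MeasurableSpace ι]
    [DiscreteMeasurableSpace ι] (x : stdSimplex ℝ ι) (f : ι → ℝ) :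
    ∫ i, f i ∂(simplexMeasure x) = ∑ i, x i * f i := by
  rw [simplexMeasure, integral_finsetSum_measure
    (fun i _ => Integrable.smul_measure (Integrable.of_finite) ENNReal.ofReal_ne_top)]
  refine Finset.sum_congr rfl fun i _ => ?_
  rw [integral_smul_measure, integral_dirac, ENNReal.toReal_ofReal (stdSimplex.zero_le x i),
    smul_eq_mul]

theorem integral_actLaw (π : Policy S A) (s : S) (f : S × A → ℝ) :
    ∫ x, f x ∂(actLaw π s) = actMean π (fun s a => f (s, a)) s := by
  rw [actLaw, integral_map Measurable.of_discrete.aemeasurable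
    (Measurable.of_discrete (f := f)).aestronglyMeasurable, integral_simplexMeasure]
  rfl

theorem integral_stepLaw (π : Policy S A) (P : TransitionKernel S A) (x : S × A)
    (f : S × A → ℝ) :
    ∫ y, f y ∂(stepLaw π P x) = nextMean P (actMean π (fun s a => f (s, a))) x.1 x.2 := by
  -- Writing the `bind` as a composition with a constant kernel makes the integral an iterated one.
  let K : Kernel S (S × A) := ⟨actLaw π, Measurable.of_discrete⟩
  have : IsMarkovKernel K := ⟨fun s => inferInstanceAs (IsProbabilityMeasure (actLaw π s))⟩
  have h : stepLaw π P x = (K ∘ₖ Kernel.const Unit (simplexMeasure (P x.1 x.2))) () := by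
    rw [Kernel.comp_apply, Kernel.const_apply]; rfl
  rw [h, Kernel.integral_comp (by rw [← h]; exact Integrable.of_finite), Kernel.const_apply,
    integral_simplexMeasure]
  exact Finset.sum_congr rfl fun s _ => congrArg _ (integral_actLaw π s f)

instance (π : Policy S A) (κ : ℕ → TransitionKernel S A) (s : S) :
    IsProbabilityMeasure (pathLaw π κ s) := by
  unfold pathLaw; infer_instance

theorem integral_coord_pathLaw_zero (π : Policy S A) (κ : ℕ → TransitionKernel S A) (s : S)
    (f : S × A → ℝ) :
    ∫ ω, f (ω 0) ∂(pathLaw π κ s) = actMean π (fun s a => f (s, a)) s := by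
  have h0 : (pathLaw π κ s).map (fun ω => ω 0) = actLaw π s := by
    have hf : (fun ω : ℕ → S × A => ω 0) =
        (fun x : (i : Finset.Iic 0) → S × A => x ⟨0, Finset.mem_Iic.2 le_rfl⟩) ∘
          Preorder.frestrictLe (π := fun _ => S × A) 0 := rfl
    have hm : Measurable fun x : (i : Finset.Iic 0) → S × A => x ⟨0, Finset.mem_Iic.2 le_rfl⟩ :=
      measurable_pi_apply _
    rw [pathLaw, Kernel.trajMeasure, hf, ← Measure.map_map hm (by fun_prop),
      Measure.map_comp _ _ (by fun_prop), Kernel.traj_map_frestrictLe, Kernel.partialTraj_self,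
      Measure.id_comp, Measure.map_map hm (by fun_prop)]
    exact Measure.map_id
  rw [← integral_actLaw, ← h0, integral_map (measurable_pi_apply 0).aemeasurable
    (Measurable.of_discrete (f := f)).aestronglyMeasurable]

/-- Markov property: condition on the history up to time `t`; the step kernel only reads its last
entry. -/
theorem integral_coord_pathLaw_succ (π : Policy S A) (κ : ℕ → TransitionKernel S A) (s : S) (t : ℕ)
    (f : S × A → ℝ) :
    ∫ ω, f (ω (t + 1)) ∂(pathLaw π κ s) = ∫ ω,
      nextMean (κ t) (actMean π (fun s a => f (s, a))) (ω t).1 (ω t).2 ∂(pathLaw π κ s) := by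
  have h := Kernel.map_frestrictLe_trajMeasure_compProd_eq_map_trajMeasure
    (X := fun _ => S × A) (μ₀ := actLaw π s) (κ := fun t => stepKernel π (κ t) t) (a := t)
  have hm : Measurable (fun x : (Finset.Iic t → S × A) × (S × A) => f x.2) :=
    (Measurable.of_discrete (f := f)).comp measurable_snd
  have h1 := congrArg (fun m => ∫ x, f x.2 ∂m) h
  beta_reduce at h1
  rw [integral_map (by fun_prop) hm.aestronglyMeasurable] at h1
  rw [pathLaw, ← h1, Measure.integral_compProd (Integrable.of_finite), integral_map (by fun_prop)
    (Measurable.of_discrete).aestronglyMeasurable]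
  refine integral_congr_ae (ae_of_all _ fun ω => ?_)
  exact integral_stepLaw π (κ t) (ω t) f

theorem integral_coord_pathLaw (π : Policy S A) (κ : ℕ → TransitionKernel S A) (s : S) (t : ℕ)
    (f : S → A → ℝ) :
    ∫ ω, f (ω t).1 (ω t).2 ∂(pathLaw π κ s) = stateMean π κ t (actMean π f) s := by
  induction t generalizing f with
  | zero => exact integral_coord_pathLaw_zero π κ s (fun x => f x.1 x.2)
  | succ t ih =>
    rw [integral_coord_pathLaw_succ π κ s t (fun x => f x.1 x.2), ih]
    rfl

end RobustMDP

end

/-! ### Averaging operators, returns and the robust Bellman equation. -/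

noncomputable section

namespace RobustMDP

variable {S A : Type*}

section ActMean

variable [Fintype A]

theorem actMean_mono (π : Policy S A) {f g : S → A → ℝ} (s : S) (h : ∀ a, f s a ≤ g s a) :
    actMean π f s ≤ actMean π g s :=
  Finset.sum_le_sum fun a _ => mul_le_mul_of_nonneg_left (h a) (stdSimplex.zero_le _ a)

theorem actMean_const (π : Policy S A) (c : ℝ) (s : S) : actMean π (fun _ _ => c) s = c := by
  rw [actMean, ← Finset.sum_mul, stdSimplex.sum_eq_one, one_mul]

theorem actMean_linear (π : Policy S A) (a b : ℝ) (f g : S → A → ℝ) (s : S) :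
    actMean π (fun s x => a * f s x + b * g s x) s = a * actMean π f s + b * actMean π g s := by
  simp only [actMean, Finset.mul_sum, ← Finset.sum_add_distrib]
  exact Finset.sum_congr rfl fun _ _ => by ring

theorem actMean_add_mul (π : Policy S A) (γ : ℝ) (r f : S → A → ℝ) (s : S) :
    actMean π (fun s a => r s a + γ * f s a) s = actMean π r s + γ * actMean π f s := by
  simpa using actMean_linear π 1 γ r f s

theorem actMean_mem_Icc {r : S → A → ℝ} (hr : ∀ s a, r s a ∈ Set.Icc (0 : ℝ) 1) (π : Policy S A)
    (s : S) : actMean π r s ∈ Set.Icc (0 : ℝ) 1 :=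
  ⟨(actMean_const π 0 s).ge.trans (actMean_mono π s fun a => (hr s a).1),
    (actMean_mono π s fun a => (hr s a).2).trans (actMean_const π 1 s).le⟩

end ActMean

section NextMean

variable [Fintype S]

theorem nextMean_mono (P : TransitionKernel S A) {f g : S → ℝ} (h : ∀ s, f s ≤ g s) (s : S)
    (a : A) : nextMean P f s a ≤ nextMean P g s a :=
  Finset.sum_le_sum fun s' _ => mul_le_mul_of_nonneg_left (h s') (stdSimplex.zero_le _ s')

theorem nextMean_const (P : TransitionKernel S A) (c : ℝ) (s : S) (a : A) :
    nextMean P (fun _ => c) s a = c := by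
  rw [nextMean, ← Finset.sum_mul, stdSimplex.sum_eq_one, one_mul]

theorem nextMean_linear (P : TransitionKernel S A) (a b : ℝ) (f g : S → ℝ) (s : S) (x : A) :
    nextMean P (fun s => a * f s + b * g s) s x = a * nextMean P f s x + b * nextMean P g s x := by
  simp only [nextMean, Finset.mul_sum, ← Finset.sum_add_distrib]
  exact Finset.sum_congr rfl fun _ _ => by ring

end NextMean

section StateMean

variable [Fintype S] [Fintype A] (π : Policy S A) (κ : ℕ → TransitionKernel S A)

theorem stateMean_mono (t : ℕ) {f g : S → ℝ} (h : ∀ s, f s ≤ g s) (s : S) :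
    stateMean π κ t f s ≤ stateMean π κ t g s := by
  induction t generalizing f g with
  | zero => exact h s
  | succ t ih => exact ih fun s => actMean_mono π s (nextMean_mono _ h s)

theorem stateMean_const (t : ℕ) (c : ℝ) (s : S) : stateMean π κ t (fun _ => c) s = c := by
  induction t with
  | zero => rfl
  | succ t ih =>
    have : actMean π (nextMean (κ t) fun _ => c) = fun _ => c :=
      funext fun s => (Finset.sum_congr rfl fun a _ => by rw [nextMean_const]).trans
        (actMean_const π c s)
    rw [stateMean, this, ih]

theorem stateMean_linear (t : ℕ) (a b : ℝ) (f g : S → ℝ) (s : S) :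
    stateMean π κ t (fun s => a * f s + b * g s) s
      = a * stateMean π κ t f s + b * stateMean π κ t g s := by
  induction t generalizing f g with
  | zero => rfl
  | succ t ih =>
    have : actMean π (nextMean (κ t) fun s => a * f s + b * g s)
        = fun s => a * actMean π (nextMean (κ t) f) s + b * actMean π (nextMean (κ t) g) s :=
      funext fun s => by
        rw [← actMean_linear]
        exact Finset.sum_congr rfl fun x _ => by rw [nextMean_linear]
    rw [stateMean, this, ih]
    rfl

theorem stateMean_nonneg (t : ℕ) {f : S → ℝ} (h : ∀ s, 0 ≤ f s) (s : S) :
    0 ≤ stateMean π κ t f s :=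
  (stateMean_const π κ t 0 s).ge.trans (stateMean_mono π κ t h s)

theorem stateMean_le (t : ℕ) {f : S → ℝ} {c : ℝ} (h : ∀ s, f s ≤ c) (s : S) :
    stateMean π κ t f s ≤ c :=
  (stateMean_mono π κ t h s).trans (stateMean_const π κ t c s).le

theorem stateMean_le_add (t : ℕ) {f g : S → ℝ} {c : ℝ} (h : ∀ s, f s ≤ g s + c) (s : S) :
    stateMean π κ t f s ≤ stateMean π κ t g s + c := by
  have h1 := stateMean_mono π κ t (f := f) (g := fun s => 1 * g s + c * 1)
    (fun s => by linarith [h s]) s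
  have h2 := stateMean_linear π κ t 1 c g (fun _ => 1) s
  rw [stateMean_const] at h2
  linarith

end StateMean

section Returns

variable [Fintype S] [Fintype A] [MeasurableSpace S] [DiscreteMeasurableSpace S]
  [MeasurableSpace A] [DiscreteMeasurableSpace A]
  {r : S → A → ℝ} (hr : ∀ s a, r s a ∈ Set.Icc (0 : ℝ) 1)
  (π : Policy S A) (κ : ℕ → TransitionKernel S A) (s : S)

include hr

theorem integrable_reward (t : ℕ) :
    Integrable (fun ω : ℕ → S × A => r (ω t).1 (ω t).2) (pathLaw π κ s) := by
  refine Integrable.of_bound (C := 1) (Measurable.aestronglyMeasurable ?_) (ae_of_all _ fun ω => ?_)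
  · exact (Measurable.of_discrete (f := fun x : S × A => r x.1 x.2)).comp (measurable_pi_apply t)
  · rw [Real.norm_of_nonneg (hr _ _).1]
    exact (hr _ _).2

theorem averageReturn_eq (n : ℕ) :
    averageReturn r n π κ s
      = 1 / (n : ℝ) * ∑ t ∈ Finset.range n, stateMean π κ t (actMean π r) s := by
  rw [averageReturn, integral_const_mul, integral_finsetSum _
    fun t _ => integrable_reward hr π κ s t]
  simp_rw [integral_coord_pathLaw]

theorem averageReturn_mem_Icc (n : ℕ) : averageReturn r n π κ s ∈ Set.Icc (0 : ℝ) 1 := by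
  rw [averageReturn_eq hr]
  have h0 : 0 ≤ ∑ t ∈ Finset.range n, stateMean π κ t (actMean π r) s :=
    Finset.sum_nonneg fun t _ => stateMean_nonneg π κ t (fun s => (actMean_mem_Icc hr π s).1) s
  have h1 : ∑ t ∈ Finset.range n, stateMean π κ t (actMean π r) s ≤ n := by
    simpa using Finset.sum_le_card_nsmul (Finset.range n) _ (1 : ℝ) fun t _ =>
      stateMean_le π κ t (fun s => (actMean_mem_Icc hr π s).2) s
  refine ⟨by positivity, ?_⟩
  rw [one_div_mul_eq_div]
  -- This covers `n = 0` as well, where division by zero gives `0`.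
  exact div_le_one_of_le₀ h1 (Nat.cast_nonneg n)

theorem hasSum_discountedReturn {γ : ℝ} (h0 : 0 ≤ γ) (h1 : γ < 1) :
    HasSum (fun t => γ ^ t * stateMean π κ t (actMean π r) s) (discountedReturn r γ π κ s) := by
  have hi : ∀ t, Integrable (fun ω : ℕ → S × A => γ ^ t * r (ω t).1 (ω t).2) (pathLaw π κ s) :=
    fun t => (integrable_reward hr π κ s t).const_mul _
  have hs : Summable fun t => ∫ ω, ‖γ ^ t * r (ω t).1 (ω t).2‖ ∂(pathLaw π κ s) := by
    refine Summable.of_nonneg_of_le (fun t => integral_nonneg fun ω => norm_nonneg _) (fun t => ?_)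
      (summable_geometric_of_lt_one h0 h1)
    have hb : ∀ ω : ℕ → S × A, ‖γ ^ t * r (ω t).1 (ω t).2‖ ≤ γ ^ t := fun ω => by
      rw [Real.norm_of_nonneg (mul_nonneg (pow_nonneg h0 t) (hr _ _).1)]
      exact mul_le_of_le_one_right (pow_nonneg h0 t) (hr _ _).2
    exact (integral_mono (hi t).norm (integrable_const (γ ^ t)) hb).trans (by simp)
  have h := hasSum_integral_of_summable_integral_norm hi hs
  simp_rw [integral_const_mul, integral_coord_pathLaw] at h
  exact h

/-- A terminal payoff `v` at horizon `n` is bounded and weighted by `γ ^ n`, so it disappears in the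
limit. This permits comparison with `v` by induction on the horizon. -/
theorem tendsto_discountedReturn {γ : ℝ} (h0 : 0 ≤ γ) (h1 : γ < 1) (v : S → ℝ) :
    Tendsto (fun n => ∑ t ∈ Finset.range n, γ ^ t * stateMean π κ t (actMean π r) s
      + γ ^ n * stateMean π κ n v s) atTop (nhds (discountedReturn r γ π κ s)) := by
  have h2 : Tendsto (fun n => γ ^ n * stateMean π κ n v s) atTop (nhds 0) := by
    refine (tendsto_pow_atTop_nhds_zero_of_lt_one h0 h1).zero_mul_isBoundedUnder_le ?_
    refine isBoundedUnder_of ⟨∑ s, |v s|, fun n => abs_le.2 ⟨?_, ?_⟩⟩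
    · refine (stateMean_const π κ n (-∑ s, |v s|) s).ge.trans (stateMean_mono π κ n (fun s => ?_) s)
      have := Finset.single_le_sum (f := fun s => |v s|) (fun s _ => abs_nonneg (v s))
        (Finset.mem_univ s)
      linarith [neg_abs_le (v s)]
    · refine stateMean_le π κ n (fun s => ?_) s
      exact (le_abs_self (v s)).trans (Finset.single_le_sum (f := fun s => |v s|)
        (fun s _ => abs_nonneg (v s)) (Finset.mem_univ s))
  simpa using (hasSum_discountedReturn hr π κ s h0 h1).tendsto_sum_nat.add h2

/-- By the subsolution inequality, the `n`-step return with terminal payoff `v` is nondecreasing in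
`n`, and it equals `v s` at `n = 0`. -/
theorem le_discountedReturn {γ : ℝ} (h0 : 0 ≤ γ) (h1 : γ < 1) {v : S → ℝ}
    (hv : ∀ t s, v s ≤ actMean π r s + γ * actMean π (nextMean (κ t) v) s) :
    v s ≤ discountedReturn r γ π κ s := by
  refine ge_of_tendsto' (tendsto_discountedReturn hr π κ s h0 h1 v) fun n => ?_
  induction n with
  | zero => simp [stateMean]
  | succ n ih =>
    have h2 := stateMean_mono π κ n (f := v)
      (g := fun s => 1 * actMean π r s + γ * actMean π (nextMean (κ n) v) s)
      (fun s => by linarith [hv n s]) s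
    rw [stateMean_linear, one_mul] at h2
    rw [Finset.sum_range_succ, stateMean, pow_succ]
    linarith [mul_le_mul_of_nonneg_left h2 (pow_nonneg h0 n)]

theorem discountedReturn_le {γ : ℝ} (h0 : 0 ≤ γ) (h1 : γ < 1) {v : S → ℝ}
    (hv : ∀ t s, actMean π r s + γ * actMean π (nextMean (κ t) v) s ≤ v s) :
    discountedReturn r γ π κ s ≤ v s := by
  refine le_of_tendsto' (tendsto_discountedReturn hr π κ s h0 h1 v) fun n => ?_
  induction n with
  | zero => simp [stateMean]
  | succ n ih =>
    have h2 := stateMean_mono π κ n (g := v)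
      (f := fun s => 1 * actMean π r s + γ * actMean π (nextMean (κ n) v) s)
      (fun s => by linarith [hv n s]) s
    rw [stateMean_linear, one_mul] at h2
    rw [Finset.sum_range_succ, stateMean, pow_succ]
    linarith [mul_le_mul_of_nonneg_left h2 (pow_nonneg h0 n)]

end Returns

/-- The least mean of `f s'` when `s'` is drawn from some `p ∈ U s a`. -/
def worstMean [Fintype S] (U : S → A → Set (stdSimplex ℝ S)) (f : S → ℝ) (s : S) (a : A) : ℝ :=
  ⨅ p : U s a, ∑ s', (p : stdSimplex ℝ S) s' * f s'

section WorstMean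

variable [Fintype S] {U : S → A → Set (stdSimplex ℝ S)} (hne : ∀ s a, (U s a).Nonempty)
  (hcompact : ∀ s a, IsCompact (U s a))

include hcompact in
theorem worstMean_le {P : TransitionKernel S A} {s : S} {a : A} (hP : P s a ∈ U s a)
    (f : S → ℝ) : worstMean U f s a ≤ nextMean P f s a := by
  have hc : Continuous fun p : stdSimplex ℝ S => ∑ s', p s' * f s' :=
    continuous_finsetSum _ fun s' _ =>
      ((continuous_apply s').comp continuous_subtype_val).mul continuous_const
  -- A real infimum is a lower bound only for a family that is bounded below; compactness supplies
  -- this.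
  have hb := ((hcompact s a).image hc).bddBelow
  rw [Set.image_eq_range] at hb
  exact ciInf_le hb ⟨P s a, hP⟩

include hne hcompact

/-- By compactness, one kernel of the uncertainty set is the worst one at all state-action pairs. -/
theorem exists_nextMean_eq_worstMean (f : S → ℝ) :
    ∃ P : TransitionKernel S A, (∀ s a, P s a ∈ U s a) ∧ nextMean P f = worstMean U f := by
  have h : ∀ s a, ∃ p ∈ U s a, ∀ q ∈ U s a, ∑ s', p s' * f s' ≤ ∑ s', q s' * f s' := fun s a => by
    obtain ⟨p, hp, hmin⟩ := (hcompact s a).exists_isMinOn (hne s a)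
      (f := fun p : stdSimplex ℝ S => ∑ s', p s' * f s') (Continuous.continuousOn
        (continuous_finsetSum _ fun s' _ =>
          ((continuous_apply s').comp continuous_subtype_val).mul continuous_const))
    exact ⟨p, hp, fun q hq => hmin hq⟩
  choose P hP hmin using h
  refine ⟨P, hP, funext₂ fun s a => le_antisymm ?_ (worstMean_le hcompact (hP s a) f)⟩
  have : Nonempty (U s a) := (hne s a).to_subtype
  exact le_ciInf fun p => hmin s a p p.2

/-- Monotonicity and translation by constants in a single inequality, the form that yields the
contraction property. -/
theorem worstMean_le_add {f g : S → ℝ} {c : ℝ} (h : ∀ s, f s ≤ g s + c) (s : S) (a : A) :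
    worstMean U f s a ≤ worstMean U g s a + c := by
  obtain ⟨P, hP, hPg⟩ := exists_nextMean_eq_worstMean hne hcompact g
  refine (worstMean_le hcompact (hP s a) f).trans ?_
  have h1 := nextMean_mono P (f := f) (g := fun s => 1 * g s + c * 1)
    (fun s => by linarith [h s]) s a
  rw [nextMean_linear P 1 c g (fun _ => 1), nextMean_const, hPg] at h1
  linarith

end WorstMean

/-- Blackwell's sufficient condition for the existence of a fixed point. -/
theorem exists_fixedPoint_of_discounting [Fintype S] {γ : ℝ} (h0 : 0 ≤ γ) (h1 : γ < 1)
    (T : (S → ℝ) → S → ℝ)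
    (hT : ∀ f g : S → ℝ, ∀ c, (∀ s, f s ≤ g s + c) → ∀ s, T f s ≤ T g s + γ * c) :
    ∃ v, T v = v := by
  have hc : ContractingWith ⟨γ, h0⟩ T := by
    refine ⟨h1, LipschitzWith.of_dist_le_mul fun f g => ?_⟩
    refine (dist_pi_le_iff (mul_nonneg h0 dist_nonneg)).2 fun s => ?_
    have hd : ∀ s, |f s - g s| ≤ dist f g := fun s => dist_le_pi_dist f g s
    rw [Real.dist_eq, abs_le]
    have h2 := hT f g (dist f g) (fun s => by linarith [(abs_le.1 (hd s)).2]) s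
    have h3 := hT g f (dist f g) (fun s => by linarith [(abs_le.1 (hd s)).1]) s
    change -(γ * dist f g) ≤ _ ∧ _ ≤ γ * dist f g
    constructor <;> linarith
  exact ⟨_, hc.fixedPoint_isFixedPt⟩

/-- The robust Bellman operator of a policy. -/
def robustBellman [Fintype S] [Fintype A] (U : S → A → Set (stdSimplex ℝ S)) (r : S → A → ℝ)
    (γ : ℝ) (π : Policy S A) (f : S → ℝ) : S → ℝ :=
  actMean π fun s a => r s a + γ * worstMean U f s a

theorem robustBellman_le_add [Fintype S] [Fintype A] {r : S → A → ℝ}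
    {U : S → A → Set (stdSimplex ℝ S)}
    (hne : ∀ s a, (U s a).Nonempty) (hcompact : ∀ s a, IsCompact (U s a)) {γ : ℝ} (h0 : 0 ≤ γ)
    (π : Policy S A) {f g : S → ℝ} {c : ℝ} (h : ∀ s, f s ≤ g s + c) (s : S) :
    robustBellman U r γ π f s ≤ robustBellman U r γ π g s + γ * c := by
  have h2 : robustBellman U r γ π f s ≤
      actMean π (fun s a => 1 * (r s a + γ * worstMean U g s a) + (γ * c) * 1) s :=
    actMean_mono π s fun a => by
      linarith [mul_le_mul_of_nonneg_left (worstMean_le_add hne hcompact h s a) h0]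
  rw [actMean_linear π 1 (γ * c) (fun s a => r s a + γ * worstMean U g s a) (fun _ _ => 1),
    actMean_const, one_mul, mul_one] at h2
  exact h2

theorem nonempty_adversary [Fintype S] {U : S → A → Set (stdSimplex ℝ S)}
    (hne : ∀ s a, (U s a).Nonempty) : Nonempty (Adversary U) := by
  choose P hP using hne
  exact ⟨fun _ => P, fun _ => hP⟩

section Bellman

variable [Fintype S] [Fintype A] [MeasurableSpace S] [DiscreteMeasurableSpace S]
  [MeasurableSpace A] [DiscreteMeasurableSpace A]
  {r : S → A → ℝ} (hr : ∀ s a, r s a ∈ Set.Icc (0 : ℝ) 1)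
  {U : S → A → Set (stdSimplex ℝ S)} (hne : ∀ s a, (U s a).Nonempty)
  (hcompact : ∀ s a, IsCompact (U s a)) {γ : ℝ} (h0 : 0 ≤ γ) (h1 : γ < 1) (π : Policy S A)

include hr h0 in
theorem discountedReturn_nonneg (κ : ℕ → TransitionKernel S A) (s : S) :
    0 ≤ discountedReturn r γ π κ s :=
  integral_nonneg fun _ => tsum_nonneg fun t => mul_nonneg (pow_nonneg h0 t) (hr _ _).1

include hr h0 in
theorem bddBelow_discountedReturn (s : S) :
    BddBelow (Set.range fun κ : Adversary U => discountedReturn r γ π κ s) :=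
  ⟨0, Set.forall_mem_range.2 fun κ => discountedReturn_nonneg hr h0 π κ s⟩

include hr hne h0 in
theorem robustDiscountedValue_nonneg (s : S) : 0 ≤ robustDiscountedValue U r γ π s := by
  have := nonempty_adversary hne
  exact le_ciInf fun κ => discountedReturn_nonneg hr h0 π κ s

include hne hcompact

include hr h0 h1

/-- Every kernel of every adversary does at least as well as the worst mean, so `v` is a subsolution
against each of them. -/
theorem le_robustDiscountedValue {v : S → ℝ} (hv : ∀ s, v s ≤ robustBellman U r γ π v s) (s : S) :
    v s ≤ robustDiscountedValue U r γ π s := by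
  have := nonempty_adversary hne
  refine le_ciInf fun κ => le_discountedReturn hr π κ s h0 h1 fun t s => ?_
  refine (hv s).trans ?_
  rw [← actMean_add_mul]
  exact actMean_mono π s fun a =>
    add_le_add_right (mul_le_mul_of_nonneg_left (worstMean_le hcompact (κ.2 t s a) v) h0) _

/-- Rectangularity gives one kernel that is worst for `v` at all pairs simultaneously; the adversary
that always plays it has `v` as a supersolution. -/
theorem robustDiscountedValue_le {v : S → ℝ} (hv : ∀ s, robustBellman U r γ π v s ≤ v s) (s : S) :
    robustDiscountedValue U r γ π s ≤ v s := by
  obtain ⟨P, hP, hPv⟩ := exists_nextMean_eq_worstMean hne hcompact v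
  refine (ciInf_le (bddBelow_discountedReturn hr h0 π s)
    (⟨fun _ => P, fun _ => hP⟩ : Adversary U)).trans
      (discountedReturn_le hr π (fun _ => P) s h0 h1 fun t s => ?_)
  rw [hPv, ← actMean_add_mul]
  exact hv s

theorem robustDiscountedValue_eq_of_fixedPoint {v : S → ℝ} (hv : robustBellman U r γ π v = v) :
    robustDiscountedValue U r γ π = v :=
  funext fun s => le_antisymm
    (robustDiscountedValue_le hr hne hcompact h0 h1 π (fun s => (congrFun hv s).le) s)
    (le_robustDiscountedValue hr hne hcompact h0 h1 π (fun s => (congrFun hv s).ge) s)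

theorem robustBellman_robustDiscountedValue :
    robustBellman U r γ π (robustDiscountedValue U r γ π) = robustDiscountedValue U r γ π := by
  obtain ⟨v, hv⟩ := exists_fixedPoint_of_discounting h0 h1 (robustBellman U r γ π)
    fun f g c h s => robustBellman_le_add hne hcompact h0 π h s
  rw [robustDiscountedValue_eq_of_fixedPoint hr hne hcompact h0 h1 π hv, hv]

theorem mul_robustDiscountedValue_le_one (s : S) :
    (1 - γ) * robustDiscountedValue U r γ π s ≤ 1 := by
  have h2 : 0 < 1 - γ := sub_pos.2 h1
  rw [← le_div_iff₀' h2]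
  refine robustDiscountedValue_le hr hne hcompact h0 h1 π (v := fun _ => 1 / (1 - γ))
    (fun s => ?_) s
  obtain ⟨P, hP, hPv⟩ := exists_nextMean_eq_worstMean hne hcompact fun _ => 1 / (1 - γ)
  refine (actMean_mono π s (g := fun _ _ => 1 / (1 - γ)) fun a => ?_).trans
    (actMean_const π _ s).le
  rw [← hPv, nextMean_const]
  have := (hr s a).2
  have h3 : 1 / (1 - γ) = 1 + γ * (1 / (1 - γ)) := by field_simp; ring
  linarith

end Bellman

end RobustMDP

end

/-! ### Limits of normalized discounted values: lower bound and single blocks. -/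

noncomputable section

namespace RobustMDP

variable {S A : Type*} [Fintype S] [Fintype A] [MeasurableSpace S] [DiscreteMeasurableSpace S]
  [MeasurableSpace A] [DiscreteMeasurableSpace A]

/-- The normalized robust discounted value `(1 - γ) V^π_{𝒫,γ}`. -/
def normalizedValue (U : S → A → Set (stdSimplex ℝ S)) (r : S → A → ℝ) (π : Policy S A) (γ : ℝ)
    (s : S) : ℝ :=
  (1 - γ) * robustDiscountedValue U r γ π s

/-- `ℓ` is approached by the normalized values along discount factors that tend to `1`. -/
def IsVanishingDiscountLimit (U : S → A → Set (stdSimplex ℝ S)) (r : S → A → ℝ) (π : Policy S A)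
    (ℓ : S → ℝ) : Prop :=
  ∀ δ > 0, ∀ γ₀ < 1, ∃ γ, γ₀ < γ ∧ 0 ≤ γ ∧ γ < 1 ∧ ∀ s, |normalizedValue U r π γ s - ℓ s| ≤ δ

section VanishingDiscount

variable {r : S → A → ℝ} (hr : ∀ s a, r s a ∈ Set.Icc (0 : ℝ) 1)
  {U : S → A → Set (stdSimplex ℝ S)} (hne : ∀ s a, (U s a).Nonempty)
  (hcompact : ∀ s a, IsCompact (U s a)) {π : Policy S A}

include hr hne hcompact

section Normalized

variable {γ : ℝ} (h0 : 0 ≤ γ) (h1 : γ < 1)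

include h0 h1

theorem normalizedValue_mem_Icc (s : S) : normalizedValue U r π γ s ∈ Set.Icc (0 : ℝ) 1 :=
  ⟨mul_nonneg (sub_pos.2 h1).le (robustDiscountedValue_nonneg hr hne h0 π s),
    mul_robustDiscountedValue_le_one hr hne hcompact h0 h1 π s⟩

omit hr hne hcompact h0 h1 in
theorem actMean_nextMean_normalizedValue (P : TransitionKernel S A) (s : S) :
    actMean π (nextMean P (normalizedValue U r π γ)) s
      = (1 - γ) * actMean π (nextMean P (robustDiscountedValue U r γ π)) s := by
  simp only [actMean, nextMean, normalizedValue, Finset.mul_sum]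
  exact Finset.sum_congr rfl fun _ _ => Finset.sum_congr rfl fun _ _ => by ring

theorem normalizedValue_le {P : TransitionKernel S A} (hP : ∀ s a, P s a ∈ U s a) (s : S) :
    normalizedValue U r π γ s ≤
      (1 - γ) * actMean π r s + γ * actMean π (nextMean P (normalizedValue U r π γ)) s := by
  have h : robustDiscountedValue U r γ π s ≤ actMean π r s +
      γ * actMean π (nextMean P (robustDiscountedValue U r γ π)) s := by
    rw [← actMean_add_mul]
    refine (congrFun (robustBellman_robustDiscountedValue hr hne hcompact h0 h1 π) s).ge.trans ?_
    exact actMean_mono π s fun a =>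
      add_le_add_right (mul_le_mul_of_nonneg_left (worstMean_le hcompact (hP s a) _) h0) _
  rw [actMean_nextMean_normalizedValue, normalizedValue]
  linarith [mul_le_mul_of_nonneg_left h (sub_pos.2 h1).le]

/-- The kernel that is worst for the value at this `γ` turns the Bellman inequality into an
equality. -/
theorem exists_normalizedValue_eq :
    ∃ P : TransitionKernel S A, (∀ s a, P s a ∈ U s a) ∧ ∀ s, normalizedValue U r π γ s =
      (1 - γ) * actMean π r s + γ * actMean π (nextMean P (normalizedValue U r π γ)) s := by
  obtain ⟨P, hP, hPv⟩ :=
    exists_nextMean_eq_worstMean hne hcompact (robustDiscountedValue U r γ π)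
  refine ⟨P, hP, fun s => ?_⟩
  have h : robustDiscountedValue U r γ π s = actMean π r s +
      γ * actMean π (nextMean P (robustDiscountedValue U r γ π)) s := by
    rw [← actMean_add_mul, hPv]
    exact (congrFun (robustBellman_robustDiscountedValue hr hne hcompact h0 h1 π) s).symm
  rw [actMean_nextMean_normalizedValue, normalizedValue]
  linear_combination (1 - γ) * h

end Normalized

variable {ℓ : S → ℝ} (hℓ : IsVanishingDiscountLimit U r π ℓ)

include hℓ

theorem IsVanishingDiscountLimit.mem_Icc (s : S) : ℓ s ∈ Set.Icc (0 : ℝ) 1 := by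
  constructor
  · refine le_of_forall_pos_le_add fun δ hδ => ?_
    obtain ⟨γ, -, h0, h1, h⟩ := hℓ δ hδ 0 one_pos
    linarith [(abs_le.1 (h s)).2, (normalizedValue_mem_Icc hr hne hcompact h0 h1 (π := π) s).1]
  · refine le_of_forall_pos_le_add fun δ hδ => ?_
    obtain ⟨γ, -, h0, h1, h⟩ := hℓ δ hδ 0 one_pos
    linarith [(abs_le.1 (h s)).1, (normalizedValue_mem_Icc hr hne hcompact h0 h1 (π := π) s).2]

theorem IsVanishingDiscountLimit.le_actMean_nextMean {P : TransitionKernel S A}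
    (hP : ∀ s a, P s a ∈ U s a) (s : S) : ℓ s ≤ actMean π (nextMean P ℓ) s := by
  refine le_of_forall_pos_le_add fun δ hδ => ?_
  -- One third each for replacing `ℓ` at `s`, for replacing it under the mean, and for the reward
  -- term `(1 - γ) r`.
  obtain ⟨γ, hγ, h0, h1, h⟩ := hℓ (δ / 3) (by positivity) (1 - δ / 3) (by linarith)
  have hw := normalizedValue_le hr hne hcompact h0 h1 (π := π) hP s
  have h2 : actMean π (nextMean P (normalizedValue U r π γ)) s
      ≤ actMean π (nextMean P ℓ) s + δ / 3 :=
    stateMean_le_add π (fun _ => P) 1 (fun s => by linarith [(abs_le.1 (h s)).2]) s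
  have h3 : 0 ≤ actMean π (nextMean P (normalizedValue U r π γ)) s :=
    stateMean_nonneg π (fun _ => P) 1
      (fun s => (normalizedValue_mem_Icc hr hne hcompact h0 h1 s).1) s
  have h4 := mul_le_mul_of_nonneg_left (actMean_mem_Icc hr π s).2 (sub_pos.2 h1).le
  have h5 := mul_le_mul_of_nonneg_right h1.le h3
  linarith [(abs_le.1 (h s)).1]

/-- `ℓ (S_t)` is a submartingale under every admissible adversary. -/
theorem IsVanishingDiscountLimit.monotone_stateMean {κ : ℕ → TransitionKernel S A}
    (hκ : κ ∈ Adversary U) (s : S) : Monotone fun t => stateMean π κ t ℓ s :=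
  monotone_nat_of_le_succ fun t =>
    stateMean_mono π κ t (hℓ.le_actMean_nextMean hr hne hcompact (hκ t)) s

theorem IsVanishingDiscountLimit.le_liminf {κ : ℕ → TransitionKernel S A}
    (hκ : κ ∈ Adversary U) (s : S) : ℓ s ≤ liminf (fun n => averageReturn r n π κ s) atTop := by
  refine le_of_forall_pos_le_add fun δ hδ => ?_
  rw [← sub_le_iff_le_add]
  refine le_liminf_of_le
    (isBoundedUnder_of ⟨1, fun n => (averageReturn_mem_Icc hr π κ s n).2⟩).isCoboundedUnder_ge ?_
  obtain ⟨γ, -, h0, h1, h⟩ := hℓ (δ / 2) (by positivity) 0 one_pos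
  have hγ : 0 < 1 - γ := sub_pos.2 h1
  obtain ⟨n₀, hn₀⟩ := exists_nat_gt (1 / (1 - γ) / (δ / 2))
  filter_upwards [eventually_ge_atTop (max n₀ 1)] with n hn
  have hn1 : (0 : ℝ) < n := by exact_mod_cast (le_max_right _ _).trans hn
  have hnδ : 1 / (1 - γ) ≤ n * (δ / 2) := by
    rw [← div_le_iff₀ (by positivity)]
    exact hn₀.le.trans (by exact_mod_cast (le_max_left _ _).trans hn)
  set w := normalizedValue U r π γ
  have hw := normalizedValue_mem_Icc hr hne hcompact h0 h1 (π := π) (U := U)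
  have hstep : ∀ t, stateMean π κ t w s ≤
      (1 - γ) * stateMean π κ t (actMean π r) s + γ * stateMean π κ (t + 1) w s := fun t => by
    have := stateMean_mono π κ t (normalizedValue_le hr hne hcompact h0 h1 (π := π) (hκ t)) s
    rwa [stateMean_linear] at this
  -- Summing `hstep` shifts the sum of the means of `w` by one time step, leaving only a boundary
  -- term.
  have hsum : ∀ n, (1 - γ) * ∑ t ∈ Finset.range n, stateMean π κ t w s ≤
      (1 - γ) * ∑ t ∈ Finset.range n, stateMean π κ t (actMean π r) s
        + γ * (stateMean π κ n w s - stateMean π κ 0 w s) := fun n => by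
    induction n with
    | zero => simp
    | succ n ih =>
      rw [Finset.sum_range_succ, Finset.sum_range_succ]
      linarith [hstep n]
  -- The submartingale property keeps the mean of `ℓ`, hence that of `w` up to `δ / 2`, above `ℓ s`
  -- at all times.
  have hlow : n * (ℓ s - δ / 2) ≤ ∑ t ∈ Finset.range n, stateMean π κ t w s := by
    have := Finset.card_nsmul_le_sum (Finset.range n) (fun t => stateMean π κ t w s)
      (ℓ s - δ / 2) fun t _ => by
        have h2 := stateMean_le_add π κ t (f := ℓ) (g := w) (c := δ / 2)
          (fun s => by linarith [(abs_le.1 (h s)).1]) s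
        have h3 := hℓ.monotone_stateMean hr hne hcompact hκ s (Nat.zero_le t)
        change ℓ s ≤ _ at h3
        linarith
    simpa using this
  have hw0 := stateMean_nonneg π κ 0 (fun s => (hw s).1) s
  have hwn := stateMean_le π κ n (fun s => (hw s).2) s
  have h4 : γ * (stateMean π κ n w s - stateMean π κ 0 w s) ≤ 1 := by nlinarith
  have h5 : ∑ t ∈ Finset.range n, stateMean π κ t w s ≤
      ∑ t ∈ Finset.range n, stateMean π κ t (actMean π r) s + 1 / (1 - γ) := by
    rw [← mul_le_mul_iff_right₀ hγ, mul_add, mul_one_div_cancel hγ.ne']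
    linarith [hsum n]
  rw [averageReturn_eq hr, one_div_mul_eq_div, le_div_iff₀ hn1]
  linarith

/-- Playing a worst kernel of a discount factor close to `1` for a suitable number of steps keeps
the mean cost near the mean of `ℓ`, and hardly raises the latter. -/
theorem IsVanishingDiscountLimit.exists_block {ε : ℝ} (hε : 0 < ε) (hε1 : ε ≤ 1) (M : ℕ) :
    ∃ P : TransitionKernel S A, (∀ s a, P s a ∈ U s a) ∧ ∃ N : ℕ, M ≤ N ∧
      ∀ κ ∈ Adversary U, ∀ t₀, (∀ t < N, κ (t₀ + t) = P) → ∀ s,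
        stateMean π κ (t₀ + N) ℓ s ≤ stateMean π κ t₀ ℓ s + ε ∧
        ∑ t ∈ Finset.range N, stateMean π κ (t₀ + t) (actMean π r) s
          ≤ N * (stateMean π κ t₀ ℓ s + ε) := by
  -- The block length will be `N = ⌈ε / (4 lam)⌉` with `lam = 1 - γ`. The tolerance is quadratic
  -- because the boundary error `ε ^ 2 / 16` is compared with `lam * N * (ε / 4)`, where `lam * N ≥
  -- ε / 4`. The bound on `lam` forces `N ≥ M` and makes the rounding harmless.
  obtain ⟨γ, hγ, h0, h1, h⟩ := hℓ (ε ^ 2 / 32) (by positivity) (1 - ε / 4 / (M + 1)) (by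
    have : 0 < ε / 4 / (M + 1) := by positivity
    linarith)
  obtain ⟨P, hP, hPw⟩ := exists_normalizedValue_eq hr hne hcompact h0 h1 (π := π)
  have hw := normalizedValue_mem_Icc hr hne hcompact h0 h1 (π := π) (U := U)
  set w := normalizedValue U r π γ
  set lam := 1 - γ with hlam
  have hlam0 : 0 < lam := sub_pos.2 h1
  have hlam1 : lam * (M + 1) ≤ ε / 4 := by
    rw [← le_div_iff₀ (by positivity)]; linarith
  have hM : (0 : ℝ) ≤ M := Nat.cast_nonneg M
  have hN1 : ε / 4 ≤ ⌈ε / 4 / lam⌉₊ * lam := by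
    rw [← div_le_iff₀ hlam0]; exact Nat.le_ceil _
  have hN2 : ⌈ε / 4 / lam⌉₊ * lam ≤ ε / 2 := by
    have h2 := (Nat.ceil_lt_add_one (a := ε / 4 / lam) (by positivity)).le
    have h3 := mul_le_mul_of_nonneg_right h2 hlam0.le
    rw [add_mul, div_mul_cancel₀ _ hlam0.ne'] at h3
    nlinarith
  have hMN : M ≤ ⌈ε / 4 / lam⌉₊ := by
    have : (M : ℝ) ≤ ⌈ε / 4 / lam⌉₊ := by
      refine le_trans ?_ (Nat.le_ceil _)
      rw [le_div_iff₀ hlam0]; nlinarith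
    exact_mod_cast this
  refine ⟨P, hP, ⌈ε / 4 / lam⌉₊, hMN, fun κ hκ t₀ hblock s => ?_⟩
  set N := ⌈ε / 4 / lam⌉₊
  have hstep : ∀ t < N, stateMean π κ (t₀ + t) w s =
      lam * stateMean π κ (t₀ + t) (actMean π r) s + γ * stateMean π κ (t₀ + t + 1) w s :=
    fun t ht => by
      rw [stateMean, hblock t ht, ← stateMean_linear]
      exact congrArg (fun f => stateMean π κ (t₀ + t) f s) (funext hPw)
  have hδ : ε ^ 2 ≤ ε := by nlinarith
  have hup : ∀ t, stateMean π κ t w s ≤ stateMean π κ t ℓ s + ε ^ 2 / 32 := fun t =>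
    stateMean_le_add π κ t (fun s => by linarith [(abs_le.1 (h s)).2]) s
  have hlow : ∀ t, stateMean π κ t ℓ s ≤ stateMean π κ t w s + ε ^ 2 / 32 := fun t =>
    stateMean_le_add π κ t (fun s => by linarith [(abs_le.1 (h s)).1]) s
  have hmono := hℓ.monotone_stateMean hr hne hcompact hκ s
  -- Since rewards are nonnegative and `w ≤ 1`, the Bellman equality lets the mean of `w` grow by at
  -- most `lam` per step.
  have hdrift : ∀ n ≤ N, stateMean π κ (t₀ + n) w s ≤ stateMean π κ t₀ w s + n * lam := fun n => by
    induction n with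
    | zero => simp
    | succ n ih =>
      intro hn
      have h2 := hstep n hn
      have h3 := stateMean_nonneg π κ (t₀ + n) (fun s => (actMean_mem_Icc hr π s).1) s
      have h4 := stateMean_le π κ (t₀ + n + 1) (fun s => (hw s).2) s
      push_cast
      have h5 := ih (by omega)
      have h6 : γ = 1 - lam := by rw [hlam]; ring
      rw [h6] at h2
      have h7 := mul_le_mul_of_nonneg_left h4 hlam0.le
      have h8 := mul_nonneg hlam0.le h3
      rw [← add_assoc]
      linarith
  have hend : stateMean π κ (t₀ + N) ℓ s ≤ stateMean π κ t₀ ℓ s + ε ^ 2 / 16 + ε / 2 := by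
    linarith [hdrift N le_rfl, hup t₀, hlow (t₀ + N)]
  refine ⟨by linarith, ?_⟩
  have hsum : ∀ n ≤ N, lam * ∑ t ∈ Finset.range n, stateMean π κ (t₀ + t) (actMean π r) s =
      lam * ∑ t ∈ Finset.range n, stateMean π κ (t₀ + t) w s
        + γ * (stateMean π κ t₀ w s - stateMean π κ (t₀ + n) w s) := fun n => by
    induction n with
    | zero => simp
    | succ n ih =>
      intro hn
      rw [Finset.sum_range_succ, Finset.sum_range_succ, mul_add, ih (by omega), ← add_assoc t₀]
      have h6 : lam = 1 - γ := hlam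
      linear_combination -hstep n hn + stateMean π κ (t₀ + n) w s * h6
  -- Within the block the mean of `ℓ` is largest at the end, where `hend` controls it.
  have hb : ∑ t ∈ Finset.range N, stateMean π κ (t₀ + t) w s ≤
      N * (stateMean π κ (t₀ + N) ℓ s + ε ^ 2 / 32) := by
    have := Finset.sum_le_card_nsmul (Finset.range N) (fun t => stateMean π κ (t₀ + t) w s)
      (stateMean π κ (t₀ + N) ℓ s + ε ^ 2 / 32) fun t ht =>
        (hup _).trans (add_le_add_left (hmono (by have := Finset.mem_range.1 ht; omega)) _)
    rwa [Finset.card_range, nsmul_eq_mul] at this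
  -- The mean of `ℓ` cannot decrease, so that of `w` decreases by at most twice the tolerance.
  have hdiff : γ * (stateMean π κ t₀ w s - stateMean π κ (t₀ + N) w s) ≤ ε ^ 2 / 16 := by
    have h2 : stateMean π κ t₀ w s - stateMean π κ (t₀ + N) w s ≤ ε ^ 2 / 16 := by
      have h3 : stateMean π κ t₀ ℓ s ≤ stateMean π κ (t₀ + N) ℓ s := hmono (Nat.le_add_right _ _)
      linarith [hup t₀, hlow (t₀ + N)]
    nlinarith [sq_nonneg ε]
  have hN3 : ε ^ 2 / 16 ≤ lam * (N * (ε / 4)) := by nlinarith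
  have h9 : lam * ∑ t ∈ Finset.range N, stateMean π κ (t₀ + t) (actMean π r) s ≤
      lam * (N * (stateMean π κ (t₀ + N) ℓ s + ε ^ 2 / 32) + N * (ε / 4)) := by
    rw [hsum N le_rfl, mul_add lam]
    linarith [mul_le_mul_of_nonneg_left hb hlam0.le]
  refine (le_of_mul_le_mul_left h9 hlam0).trans ?_
  rw [← mul_add]
  exact mul_le_mul_of_nonneg_left (by linarith) (Nat.cast_nonneg N)

end VanishingDiscount

end RobustMDP

end

/-! ### Concatenation of blocks and the vanishing discount limit. -/

noncomputable section

namespace RobustMDP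

/-- Each time lies in one of the blocks that a strictly increasing sequence cuts out. -/
theorem exists_blockIndex {T : ℕ → ℕ} (hT : StrictMono T) :
    ∃ idx : ℕ → ℕ, ∀ k t, T k ≤ t → t < T (k + 1) → idx t = k := by
  -- Searching up to `t` suffices because `k ≤ T k`.
  refine ⟨fun t => Nat.findGreatest (fun k => T k ≤ t) t, fun k t h1 h2 => ?_⟩
  refine Nat.findGreatest_eq_iff.2 ⟨(hT.id_le k).trans h1, fun _ => h1, fun n hn _ h => ?_⟩
  have := hT.monotone (Nat.succ_le_of_lt hn)
  simp only [Nat.succ_eq_add_one] at this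
  omega

variable {S A : Type*} [Fintype S] [Fintype A] [MeasurableSpace S] [DiscreteMeasurableSpace S]
  [MeasurableSpace A] [DiscreteMeasurableSpace A]

section VanishingDiscount

variable {r : S → A → ℝ} (hr : ∀ s a, r s a ∈ Set.Icc (0 : ℝ) 1)
  {U : S → A → Set (stdSimplex ℝ S)} (hne : ∀ s a, (U s a).Nonempty)
  (hcompact : ∀ s a, IsCompact (U s a)) (π : Policy S A)

include hr

theorem isBoundedUnder_ge_averageReturn (κ : ℕ → TransitionKernel S A) (s : S) :
    IsBoundedUnder (· ≥ ·) atTop fun n => averageReturn r n π κ s :=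
  isBoundedUnder_of ⟨0, fun n => (averageReturn_mem_Icc hr π κ s n).1⟩

theorem bddBelow_liminf_averageReturn (s : S) :
    BddBelow (Set.range fun κ : Adversary U => liminf (fun n => averageReturn r n π κ s) atTop) :=
  ⟨0, Set.forall_mem_range.2 fun κ => le_liminf_of_le
    (isBoundedUnder_of ⟨1, fun n => (averageReturn_mem_Icc hr π κ s n).2⟩).isCoboundedUnder_ge
    (Eventually.of_forall fun n => (averageReturn_mem_Icc hr π κ s n).1)⟩

include hne in
theorem robustAverageReward_le_one (s : S) : robustAverageReward U r π s ≤ 1 := by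
  obtain ⟨κ⟩ := nonempty_adversary hne
  refine (ciInf_le (bddBelow_liminf_averageReturn hr π s) κ).trans ?_
  exact liminf_le_of_frequently_le (Frequently.of_forall
    fun n => (averageReturn_mem_Icc hr π κ s n).2) (isBoundedUnder_ge_averageReturn hr π κ s)

include hne hcompact

variable {π} {ℓ : S → ℝ} (hℓ : IsVanishingDiscountLimit U r π ℓ)

include hℓ

/-- Concatenating blocks of rapidly growing lengths gives an adversary whose average cost is
near `ℓ` at the end of each block. -/
theorem IsVanishingDiscountLimit.exists_liminf_le {ε : ℝ} (hε : 0 < ε) (hε1 : ε ≤ 1) :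
    ∃ κ ∈ Adversary U, ∀ s, liminf (fun n => averageReturn r n π κ s) atTop ≤ ℓ s + 2 * ε := by
  -- The tolerances `ε / 2 ^ (k + 1)` sum to `ε`, so the mean of `ℓ` never exceeds `ℓ s + ε` at a
  -- block start.
  choose P hP N hN hblock using fun k M : ℕ =>
    hℓ.exists_block hr hne hcompact (ε := ε * (1 / 2) ^ (k + 1)) (by positivity)
      (mul_le_one₀ hε1 (by positivity) (pow_le_one₀ (by norm_num) (by norm_num))) M
  -- Block `k` is at least `k + 1` times as long as all the past, which makes the past negligible;
  -- the extra `+ 1` keeps `T` strictly increasing from `T 0 = 0`.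
  obtain ⟨T, hT0, hT⟩ : ∃ T : ℕ → ℕ, T 0 = 0 ∧
      ∀ k, T (k + 1) = T k + N k ((k + 1) * T k + 1) :=
    ⟨fun n => Nat.rec 0 (fun k Tk => Tk + N k ((k + 1) * Tk + 1)) n, rfl, fun k => rfl⟩
  have hTmono : StrictMono T := strictMono_nat_of_lt_succ fun k => by
    have := hN k ((k + 1) * T k + 1)
    rw [hT]; omega
  obtain ⟨idx, hidx⟩ := exists_blockIndex hTmono
  have hκ : (fun t => P (idx t) ((idx t + 1) * T (idx t) + 1)) ∈ Adversary U :=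
    fun t s a => hP _ _ s a
  set κ : ℕ → TransitionKernel S A := fun t => P (idx t) ((idx t + 1) * T (idx t) + 1) with hκdef
  refine ⟨κ, hκ, fun s => ?_⟩
  have hb := fun k => hblock k ((k + 1) * T k + 1) κ hκ (T k) (fun t ht => by
    have : idx (T k + t) = k := hidx k _ (Nat.le_add_right _ _) (by rw [hT]; omega)
    simp only [hκdef, this]) s
  have hy : ∀ k, stateMean π κ (T k) ℓ s ≤ ℓ s + ε * (1 - (1 / 2) ^ k) := fun k => by
    induction k with
    | zero => simp [hT0, stateMean]
    | succ k ih =>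
      rw [hT]
      refine (hb k).1.trans ((add_le_add_left ih _).trans (le_of_eq ?_))
      ring
  -- Rewards before block `k` are bounded trivially by `1` each.
  have hsum : ∀ k, ∑ t ∈ Finset.range (T (k + 1)), stateMean π κ t (actMean π r) s ≤
      (T k : ℝ) + N k ((k + 1) * T k + 1) * (ℓ s + ε) := fun k => by
    rw [hT, Finset.sum_range_add]
    refine add_le_add ?_ ((hb k).2.trans (mul_le_mul_of_nonneg_left ?_ (Nat.cast_nonneg _)))
    · simpa using Finset.sum_le_card_nsmul (Finset.range (T k)) _ (1 : ℝ) fun t _ =>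
        stateMean_le π κ t (fun s => (actMean_mem_Icc hr π s).2) s
    · have h2 : ε * (1 / 2) ^ (k + 1) ≤ ε * (1 / 2) ^ k := by
        rw [pow_succ]
        have : 0 ≤ ε * (1 / 2) ^ k := by positivity
        linarith
      linarith [hy k]
  refine liminf_le_of_frequently_le (frequently_atTop.2 fun n₀ => ?_)
    (isBoundedUnder_ge_averageReturn hr π κ s)
  obtain ⟨m, hm⟩ := exists_nat_gt (1 / ε)
  obtain ⟨k, hk⟩ : ∃ k, k = max n₀ m := ⟨_, rfl⟩
  have hkε : 1 ≤ (k + 1) * ε := by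
    rw [← div_le_iff₀ hε]
    have : (m : ℝ) ≤ k := by exact_mod_cast hk ▸ le_max_right _ _
    linarith
  refine ⟨T (k + 1), ?_, ?_⟩
  · have := hTmono.id_le (k + 1)
    simp only [id] at this
    have := le_max_left n₀ m
    omega
  have hpos : (0 : ℝ) < T (k + 1) := by
    exact_mod_cast (Nat.zero_le _).trans_lt (hTmono (Nat.lt_succ_self k))
  rw [averageReturn_eq hr, one_div_mul_eq_div, div_le_iff₀ hpos]
  refine (hsum k).trans ?_
  have hNk : ((k : ℝ) + 1) * T k ≤ N k ((k + 1) * T k + 1) := by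
    exact_mod_cast (Nat.le_succ _).trans (hN k ((k + 1) * T k + 1))
  have hcast : (T (k + 1) : ℝ) = T k + N k ((k + 1) * T k + 1) := by exact_mod_cast hT k
  rw [hcast]
  have hℓ0 := (hℓ.mem_Icc hr hne hcompact s).1
  have hTk : (0 : ℝ) ≤ T k := Nat.cast_nonneg _
  have h3 : (T k : ℝ) ≤ N k ((k + 1) * T k + 1) * ε := by
    have h4 := mul_le_mul_of_nonneg_right hNk hε.le
    have h5 := mul_le_mul_of_nonneg_right hkε hTk
    linarith
  have h6 : 0 ≤ T k * (ℓ s + 2 * ε) := by positivity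
  linarith

theorem IsVanishingDiscountLimit.eq_robustAverageReward : ℓ = robustAverageReward U r π := by
  have := nonempty_adversary hne
  refine funext fun s => le_antisymm
    (le_ciInf fun κ => hℓ.le_liminf hr hne hcompact κ.2 s) ?_
  refine le_of_forall_pos_le_add fun δ hδ => ?_
  obtain ⟨κ, hκ, h⟩ := hℓ.exists_liminf_le hr hne hcompact (ε := min (δ / 2) 1)
    (by positivity) (min_le_right _ _)
  refine (ciInf_le (bddBelow_liminf_averageReturn hr π s) (⟨κ, hκ⟩ : Adversary U)).trans
    ((h s).trans ?_)
  linarith [min_le_left (δ / 2) 1]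

omit hℓ

variable (π) in
/-- The vanishing discount limit: `(1 - γ) V^π_{𝒫,γ} → g^π_𝒫` as `γ → 1`. -/
theorem tendsto_normalizedValue :
    Tendsto (normalizedValue U r π) (nhdsWithin 1 (Set.Iio 1))
      (nhds (robustAverageReward U r π)) := by
  have hmem : ∀ γ₀ < (1 : ℝ), ∀ᶠ γ in nhdsWithin (1 : ℝ) (Set.Iio 1), γ₀ < γ ∧ 0 ≤ γ ∧ γ < 1 :=
    fun γ₀ hγ₀ => by
      filter_upwards [Ioo_mem_nhdsLT (max_lt hγ₀ one_pos)] with γ hγ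
      exact ⟨(le_max_left _ _).trans_lt hγ.1, ((le_max_right _ _).trans_lt hγ.1).le, hγ.2⟩
  -- In a compact cube convergence follows from uniqueness of the cluster point, and each cluster
  -- point is an `IsVanishingDiscountLimit`.
  refine (isCompact_univ_pi fun _ : S => isCompact_Icc (a := (0 : ℝ)) (b := 1)
    ).tendsto_nhds_of_unique_mapClusterPt ?_ fun ℓ _ hℓ => ?_
  · filter_upwards [hmem 0 one_pos] with γ hγ
    exact fun s _ => normalizedValue_mem_Icc hr hne hcompact hγ.2.1 hγ.2.2 s
  · refine IsVanishingDiscountLimit.eq_robustAverageReward hr hne hcompact fun δ hδ γ₀ hγ₀ => ?_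
    obtain ⟨γ, hγ, h0⟩ := ((mapClusterPt_iff_frequently.1 hℓ _
      (Metric.closedBall_mem_nhds ℓ hδ)).and_eventually (hmem γ₀ hγ₀)).exists
    exact ⟨γ, h0.1, h0.2.1, h0.2.2, fun s => (dist_le_pi_dist _ _ s).trans hγ⟩

end VanishingDiscount

end RobustMDP

end

/-! ### Deterministic selections and passage from discounted to average optimality. -/

noncomputable section

namespace RobustMDP

section PurePolicy

variable {S A : Type*} [Fintype A]

open Classical in
/-- The deterministic policy that plays `f s` in state `s`. -/
def purePolicy (f : S → A) : Policy S A := fun s => stdSimplex.vertex (f s)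

theorem purePolicy_apply_self (f : S → A) (s : S) : purePolicy f s (f s) = 1 := by
  simp [purePolicy]

theorem isDeterministic_purePolicy (f : S → A) : IsDeterministic (purePolicy f) :=
  fun s => ⟨f s, purePolicy_apply_self f s⟩

theorem purePolicy_injective : Function.Injective (purePolicy : (S → A) → Policy S A) :=
  fun f g h => funext fun s => by
    classical
    exact stdSimplex.vertex_injective (S := ℝ) (by simpa [purePolicy] using congrFun h s)

theorem eq_purePolicy {π : Policy S A} {f : S → A} (h : ∀ s a, a ≠ f s → π s a = 0) :
    π = purePolicy f := by
  classical
  refine funext fun s => ?_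
  have h1 : π s (f s) = 1 := by
    rw [← stdSimplex.sum_eq_one (π s)]
    exact (Finset.sum_eq_single _ (fun a _ ha => h s a ha) (by simp)).symm
  refine DFunLike.ext _ _ fun a => ?_
  by_cases ha : a = f s
  · rw [ha, h1, purePolicy_apply_self]
  · rw [h s a ha]
    simp [purePolicy, ha]

theorem actMean_purePolicy (f : S → A) (h : S → A → ℝ) (s : S) :
    actMean (purePolicy f) h s = h s (f s) := by
  classical
  simp [actMean, purePolicy, Pi.single_apply]

theorem exists_pos_le_actMean (π : Policy S A) (h : S → A → ℝ) (s : S) :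
    ∃ a, 0 < π s a ∧ h s a ≤ actMean π h s := by
  by_contra! hlt
  have h1 : ∑ a, π s a * (h s a - actMean π h s) = 0 := by
    simp only [mul_sub, Finset.sum_sub_distrib, ← Finset.sum_mul, stdSimplex.sum_eq_one]
    rw [one_mul, actMean, sub_self]
  have h2 : ∀ a, 0 ≤ π s a * (h s a - actMean π h s) := fun a => by
    rcases (stdSimplex.zero_le (π s) a).eq_or_lt with h0 | h0
    · rw [← h0, zero_mul]
    · exact mul_nonneg h0.le (sub_pos.2 (hlt a h0)).le
  have h3 : ∀ a, π s a = 0 := fun a => by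
    by_contra h0
    have h0 : 0 < π s a := (stdSimplex.zero_le (π s) a).lt_of_ne' h0
    have := (Finset.sum_eq_zero_iff_of_nonneg fun a _ => h2 a).1 h1 a (Finset.mem_univ a)
    exact (mul_pos h0 (sub_pos.2 (hlt a h0))).ne' this
  have := stdSimplex.sum_eq_one (π s)
  simp [h3] at this

/-- The deficits below the mean are nonnegative and have weighted sum zero, so each vanishes where
the weight is positive. -/
theorem eq_actMean_of_le {π : Policy S A} {h : S → A → ℝ} {s : S}
    (hle : ∀ a, h s a ≤ actMean π h s) {a : A} (ha : 0 < π s a) : h s a = actMean π h s := by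
  have h1 : ∑ a, π s a * (actMean π h s - h s a) = 0 := by
    simp only [mul_sub, Finset.sum_sub_distrib, ← Finset.sum_mul, stdSimplex.sum_eq_one]
    rw [one_mul, actMean, sub_self]
  have h2 := (Finset.sum_eq_zero_iff_of_nonneg fun a _ =>
    mul_nonneg (stdSimplex.zero_le (π s) a) (sub_nonneg.2 (hle a))).1 h1 a (Finset.mem_univ a)
  linarith [(mul_eq_zero.1 h2).resolve_left ha.ne']

/-- A second action in the support at some state would, by changing a selection there, give two
different pure policies both equal to `π₀`. -/
theorem eq_of_forall_selection_eq {π π₀ : Policy S A}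
    (h : ∀ f : S → A, (∀ s, 0 < π s (f s)) → purePolicy f = π₀) : π = π₀ := by
  classical
  choose f hf _ using exists_pos_le_actMean π fun _ _ => 0
  rw [← h f hf]
  refine eq_purePolicy fun s a ha => ?_
  by_contra h0
  have h0 : 0 < π s a := (stdSimplex.zero_le (π s) a).lt_of_ne' h0
  have hu : ∀ s', 0 < π s' (Function.update f s a s') := fun s' => by
    by_cases hs : s' = s
    · subst hs; simpa using h0
    · simpa [hs] using hf s'
  have := congrFun (purePolicy_injective ((h _ hu).trans (h f hf).symm)) s
  exact ha (by simpa using this)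

end PurePolicy

theorem eventually_discountFactor :
    ∀ᶠ γ in nhdsWithin (1 : ℝ) (Set.Iio 1), 0 ≤ γ ∧ γ < 1 := by
  filter_upwards [Ioo_mem_nhdsLT one_pos] with γ hγ using ⟨hγ.1.le, hγ.2⟩

variable {S A : Type*} [Fintype S] [Fintype A] [MeasurableSpace S] [DiscreteMeasurableSpace S]
  [MeasurableSpace A] [DiscreteMeasurableSpace A]
  {r : S → A → ℝ} (hr : ∀ s a, r s a ∈ Set.Icc (0 : ℝ) 1)
  {U : S → A → Set (stdSimplex ℝ S)} (hne : ∀ s a, (U s a).Nonempty)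
  (hcompact : ∀ s a, IsCompact (U s a))

include hr hne hcompact

section Discounted

variable {γ : ℝ} (h0 : 0 ≤ γ) (h1 : γ < 1)

include h0 h1

theorem robustDiscountedValue_le_optimal (π : Policy S A) (s : S) :
    robustDiscountedValue U r γ π s ≤ optimalDiscountedValue U r γ s := by
  refine le_ciSup (f := fun π : Policy S A => robustDiscountedValue U r γ π s)
    ⟨1 / (1 - γ), Set.forall_mem_range.2 fun π => ?_⟩ π
  rw [le_div_iff₀' (sub_pos.2 h1)]
  exact mul_robustDiscountedValue_le_one hr hne hcompact h0 h1 π s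

/-- The optimal robust discounted value satisfies the optimality equation, and a greedy
deterministic policy attains it. -/
theorem optimalDiscountedValue_spec [Nonempty A] :
    (∀ s a, r s a + γ * worstMean U (optimalDiscountedValue U r γ) s a
      ≤ optimalDiscountedValue U r γ s) ∧
    ∃ f : S → A, robustDiscountedValue U r γ (purePolicy f) = optimalDiscountedValue U r γ := by
  -- The fixed point of the optimality operator is a supersolution for every policy and the exact
  -- value of a greedy one, hence the optimal value.
  obtain ⟨v, hv⟩ := exists_fixedPoint_of_discounting h0 h1
    (fun f s => ⨆ a, (r s a + γ * worstMean U f s a)) fun f g c h s => ciSup_le fun a => by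
      have h2 := mul_le_mul_of_nonneg_left (worstMean_le_add hne hcompact h s a) h0
      have h3 := le_ciSup (Set.finite_range fun a => r s a + γ * worstMean U g s a).bddAbove a
      linarith
  have hle : ∀ s a, r s a + γ * worstMean U v s a ≤ v s := fun s a =>
    (le_ciSup (Set.finite_range fun a => r s a + γ * worstMean U v s a).bddAbove a).trans
      (congrFun hv s).le
  choose f hf using fun s => exists_eq_ciSup_of_finite (f := fun a => r s a + γ * worstMean U v s a)
  have hfv : robustDiscountedValue U r γ (purePolicy f) = v := by
    refine robustDiscountedValue_eq_of_fixedPoint hr hne hcompact h0 h1 _ (funext fun s => ?_)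
    rw [robustBellman, actMean_purePolicy, hf s]
    exact congrFun hv s
  have hopt : optimalDiscountedValue U r γ = v := by
    refine funext fun s => le_antisymm ?_ ?_
    · have : Nonempty (Policy S A) := ⟨purePolicy f⟩
      exact ciSup_le fun π => robustDiscountedValue_le hr hne hcompact h0 h1 π
        (fun s => (actMean_mono π s (hle s)).trans (actMean_const π (v s) s).le) s
    · rw [← hfv]
      exact robustDiscountedValue_le_optimal hr hne hcompact h0 h1 _ s
  rw [hopt]
  exact ⟨hle, f, hfv⟩

/-- Every deterministic selection from the support of a discount optimal policy is discount
optimal. -/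
theorem optimal_of_selection [Nonempty A] {π : Policy S A}
    (hπ : robustDiscountedValue U r γ π = optimalDiscountedValue U r γ) {f : S → A}
    (hf : ∀ s, 0 < π s (f s)) :
    robustDiscountedValue U r γ (purePolicy f) = optimalDiscountedValue U r γ := by
  have hle := (optimalDiscountedValue_spec hr hne hcompact h0 h1).1
  have hb := robustBellman_robustDiscountedValue hr hne hcompact h0 h1 π
  rw [hπ] at hb
  refine robustDiscountedValue_eq_of_fixedPoint hr hne hcompact h0 h1 _ (funext fun s => ?_)
  have hs := congrFun hb s
  rw [robustBellman] at hs
  rw [robustBellman, actMean_purePolicy, ← hs]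
  -- No action value exceeds the optimal value, while their mean under `π` equals it; thus every
  -- action in the support attains it.
  have := eq_actMean_of_le (π := π) (s := s)
    (h := fun s a => r s a + γ * worstMean U (optimalDiscountedValue U r γ) s a)
    (fun a => (hle s a).trans hs.ge) (hf s)
  rw [← this]

/-- Some deterministic selection from the support of a policy does not have a larger value. -/
theorem exists_selection_le (π : Policy S A) :
    ∃ f : S → A, (∀ s, 0 < π s (f s)) ∧
      ∀ s, robustDiscountedValue U r γ (purePolicy f) s ≤ robustDiscountedValue U r γ π s := by
  -- Choosing in each state a supported action no better than average makes the value of `π` a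
  -- supersolution for `f`.
  choose f hf hle using exists_pos_le_actMean π
    fun s a => r s a + γ * worstMean U (robustDiscountedValue U r γ π) s a
  refine ⟨f, hf, robustDiscountedValue_le hr hne hcompact h0 h1 _ fun s => ?_⟩
  rw [robustBellman, actMean_purePolicy]
  exact (hle s).trans
    (congrFun (robustBellman_robustDiscountedValue hr hne hcompact h0 h1 π) s).le

end Discounted

/-- Both normalized values converge, so comparing them along some discount factors tending to `1` is
enough. -/
theorem robustAverageReward_le_of_frequently {π π' : Policy S A}
    (h : ∃ᶠ γ in nhdsWithin (1 : ℝ) (Set.Iio 1), ∀ s,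
      robustDiscountedValue U r γ π s ≤ robustDiscountedValue U r γ π' s) (s : S) :
    robustAverageReward U r π s ≤ robustAverageReward U r π' s := by
  refine le_of_tendsto_of_tendsto_of_frequently
    (tendsto_pi_nhds.1 (tendsto_normalizedValue hr hne hcompact π) s)
    (tendsto_pi_nhds.1 (tendsto_normalizedValue hr hne hcompact π') s) ?_
  refine (h.and_eventually eventually_discountFactor).mono fun γ hγ => ?_
  exact mul_le_mul_of_nonneg_left (hγ.1 s) (sub_pos.2 hγ.2.2).le

omit hcompact in
theorem robustAverageReward_le_optimal (π : Policy S A) (s : S) :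
    robustAverageReward U r π s ≤ optimalAverageReward U r s :=
  le_ciSup (f := fun π : Policy S A => robustAverageReward U r π s)
    ⟨1, Set.forall_mem_range.2 fun π => robustAverageReward_le_one hr hne π s⟩ π

theorem mem_averageOptimalPolicies_of_frequently {π : Policy S A}
    (h : ∃ᶠ γ in nhdsWithin (1 : ℝ) (Set.Iio 1),
      robustDiscountedValue U r γ π = optimalDiscountedValue U r γ) :
    π ∈ averageOptimalPolicies U r := by
  refine funext fun s => le_antisymm (robustAverageReward_le_optimal hr hne π s) ?_
  have : Nonempty (Policy S A) := ⟨π⟩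
  refine ciSup_le fun π' => robustAverageReward_le_of_frequently hr hne hcompact ?_ s
  refine (h.and_eventually eventually_discountFactor).mono fun γ hγ s => ?_
  rw [hγ.1]
  exact robustDiscountedValue_le_optimal hr hne hcompact hγ.2.1 hγ.2.2 π' s

theorem mem_averageOptimalPolicies_of_selections {π : Policy S A}
    (h : ∀ f : S → A, (∀ s, 0 < π s (f s)) → purePolicy f ∈ averageOptimalPolicies U r) :
    π ∈ averageOptimalPolicies U r := by
  obtain ⟨f, hf⟩ : ∃ f : S → A, ∃ᶠ γ in nhdsWithin (1 : ℝ) (Set.Iio 1), (∀ s, 0 < π s (f s)) ∧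
      ∀ s, robustDiscountedValue U r γ (purePolicy f) s ≤ robustDiscountedValue U r γ π s := by
    -- The selection depends on `γ`, but there are finitely many, so one of them serves for discount
    -- factors arbitrarily close to `1`.
    refine frequently_exists.1 (Eventually.frequently ?_)
    filter_upwards [eventually_discountFactor] with γ h01
    exact exists_selection_le hr hne hcompact h01.1 h01.2 π
  refine funext fun s => le_antisymm (robustAverageReward_le_optimal hr hne π s) ?_
  rw [← h f hf.exists.choose_spec.1]
  exact robustAverageReward_le_of_frequently hr hne hcompact (hf.mono fun γ hγ => hγ.2) s

/-- Each deterministic policy is either discount optimal frequently as `γ → 1`, hence average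
optimal, or eventually never. Finiteness makes the threshold uniform, and selections transfer it to
randomized policies. -/
theorem eventually_optimal_mem_averageOptimalPolicies [Nonempty A] :
    ∀ᶠ γ in nhdsWithin (1 : ℝ) (Set.Iio 1), ∀ π : Policy S A,
      robustDiscountedValue U r γ π = optimalDiscountedValue U r γ →
        π ∈ averageOptimalPolicies U r := by
  have h : ∀ᶠ γ in nhdsWithin (1 : ℝ) (Set.Iio 1), ∀ f : S → A,
      robustDiscountedValue U r γ (purePolicy f) = optimalDiscountedValue U r γ →
        purePolicy f ∈ averageOptimalPolicies U r := by
    refine eventually_all.2 fun f => ?_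
    by_cases hf : ∃ᶠ γ in nhdsWithin (1 : ℝ) (Set.Iio 1),
        robustDiscountedValue U r γ (purePolicy f) = optimalDiscountedValue U r γ
    · exact Eventually.of_forall fun _ _ =>
        mem_averageOptimalPolicies_of_frequently hr hne hcompact hf
    · exact (not_frequently.1 hf).mono fun γ hγ h => absurd h hγ
  filter_upwards [h, eventually_discountFactor] with γ hγ h01 π hπ
  exact mem_averageOptimalPolicies_of_selections hr hne hcompact fun f hf =>
    hγ f (optimal_of_selection hr hne hcompact h01.1 h01.2 hπ hf)

omit hcompact in
theorem mem_deterministicArgmax {π : Policy S A} (hd : IsDeterministic π)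
    (hπ : π ∈ averageOptimalPolicies U r) : π ∈ deterministicArgmax U r :=
  ⟨hd, fun π' _ s => (robustAverageReward_le_optimal hr hne π' s).trans (congrFun hπ s).ge⟩

end RobustMDP

end

/-! ### The main theorem. -/

theorem theorem5 {S A : Type*} [Fintype S] [Fintype A] [Nonempty A]
    [MeasurableSpace S] [DiscreteMeasurableSpace S]
    [MeasurableSpace A] [DiscreteMeasurableSpace A]
    (r : S → A → ℝ) (hr : ∀ s a, r s a ∈ Set.Icc (0 : ℝ) 1)
    (U : S → A → Set (stdSimplex ℝ S))
    (hne : ∀ s a, (U s a).Nonempty) (hcompact : ∀ s a, IsCompact (U s a)) :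
    (∃ δ : ℝ, 0 < δ ∧ δ < 1 ∧ ∀ γ : ℝ, δ < γ → γ < 1 →
      (∃ π ∈ RobustMDP.averageOptimalPolicies U r, RobustMDP.IsDeterministic π ∧
        RobustMDP.robustDiscountedValue U r γ π = RobustMDP.optimalDiscountedValue U r γ) ∧
      ∀ π : RobustMDP.Policy S A,
        RobustMDP.robustDiscountedValue U r γ π = RobustMDP.optimalDiscountedValue U r γ →
          π ∈ RobustMDP.averageOptimalPolicies U r) ∧
    ((∃ π : RobustMDP.Policy S A, RobustMDP.deterministicArgmax U r = {π}) →
      ∃! π : RobustMDP.Policy S A, RobustMDP.IsBlackwellOptimal U r π) := by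
  obtain ⟨δ, hδ, hopt⟩ : ∃ δ ∈ Set.Ioo (0 : ℝ) 1, ∀ γ : ℝ, δ < γ → γ < 1 →
      ∀ π : RobustMDP.Policy S A,
        RobustMDP.robustDiscountedValue U r γ π = RobustMDP.optimalDiscountedValue U r γ →
          π ∈ RobustMDP.averageOptimalPolicies U r := by
    obtain ⟨l, hl, hsub⟩ := (mem_nhdsLT_iff_exists_Ioo_subset' (zero_lt_one' ℝ)).1
      (RobustMDP.eventually_optimal_mem_averageOptimalPolicies hr hne hcompact)
    -- The maximum with `1 / 2` keeps `δ` positive, so all discount factors considered are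
    -- nonnegative.
    exact ⟨max l (1 / 2), ⟨by positivity, max_lt hl (by norm_num)⟩,
      fun γ h1 h2 => hsub ⟨(le_max_left _ _).trans_lt h1, h2⟩⟩
  have hgreedy := fun (γ : ℝ) (h1 : δ < γ) (h2 : γ < 1) =>
    (RobustMDP.optimalDiscountedValue_spec hr hne hcompact (hδ.1.trans h1).le h2).2
  refine ⟨⟨δ, hδ.1, hδ.2, fun γ h1 h2 => ⟨?_, hopt γ h1 h2⟩⟩, ?_⟩
  · obtain ⟨f, hf⟩ := hgreedy γ h1 h2
    exact ⟨_, hopt γ h1 h2 _ hf, RobustMDP.isDeterministic_purePolicy f, hf⟩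
  · rintro ⟨π₀, hπ₀⟩
    have huniq : ∀ γ : ℝ, δ < γ → γ < 1 → ∀ f : S → A,
        RobustMDP.robustDiscountedValue U r γ (RobustMDP.purePolicy f)
          = RobustMDP.optimalDiscountedValue U r γ → RobustMDP.purePolicy f = π₀ :=
      fun γ h1 h2 f hf => by
        have := RobustMDP.mem_deterministicArgmax hr hne
          (RobustMDP.isDeterministic_purePolicy f) (hopt γ h1 h2 _ hf)
        rwa [hπ₀] at this
    refine ⟨π₀, ⟨δ, hδ.1, hδ.2, fun γ h1 h2 => ?_⟩, fun π hπ => ?_⟩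
    · obtain ⟨f, hf⟩ := hgreedy γ h1 h2
      rwa [huniq γ h1 h2 f hf] at hf
    · obtain ⟨δ', -, hδ', hB⟩ := hπ
      -- A single discount factor beyond both thresholds decides uniqueness.
      obtain ⟨γ, h1, h2⟩ := exists_between (max_lt hδ.2 hδ')
      have h1δ := (le_max_left _ _).trans_lt h1
      exact RobustMDP.eq_of_forall_selection_eq fun f hf => huniq γ h1δ h2 f
        (RobustMDP.optimal_of_selection hr hne hcompact (hδ.1.trans h1δ).le h2
          (hB γ ((le_max_right _ _).trans_lt h1) h2) hf)
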